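/- Theorem. Let $G$ be a finite undirected multigraph that is $k$-edge-connected, i.e. any two distinct vertices of $G$ are joined by $k$ pairwise edge-disjoint paths, and let $d$ be a vertex of $G$ (the destination). Then there is a set of $\lfloor k/2\rfloor$-resilient deterministic routing functions for $G$ and $d$. Here a set of deterministic routing functions consists of one function $f_v$ for each vertex $v$; $f_v$ takes the set of active (non-failed) edges incident with $v$ and the edge along which a packet arrived at $v$ (or the information that the packet originated at $v$), and returns an active edge incident with $v$ along which the packet is forwarded, or no edge, in which case the packet is not forwarded. Given a set $F$ of failed edges, a packet that originates at a vertex $v$ is forwarded hop by hop by these functions. The functions are $c$-resilient if, for every set $F$ of at most $c$ failed edges and every vertex $v$ that is still joined to $d$ by a path in $G\setminus F$, a packet originated at $v$ reaches $d$. The routing functions may depend on $G$ and $d$, but not on $F$ or on the origin of the packet (except through the arguments listed above). -/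

import Mathlib

namespace FailoverRouting

variable {α β : Type*}

/-- `IsWalk G x p y`: the list `p` of pairs (edge, next vertex) is a walk of the undirected
multigraph `G` from the vertex `x` to the vertex `y`. -/
def IsWalk (G : Graph α β) : α → List (β × α) → α → Prop
  | x, [], y => x ∈ G.vertexSet ∧ x = y
  | x, (e, z) :: p, y => G.IsLink e x z ∧ IsWalk G z p y

/-- A path is a walk that visits no vertex twice. -/
def IsPath (G : Graph α β) (x : α) (p : List (β × α)) (y : α) : Prop :=
  IsWalk G x p y ∧ (x :: p.map Prod.snd).Nodup

/-- `G` is `k`-edge-connected: between any two different vertices there are `k` paths, no two of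
which have an edge in common. -/
def EdgeConnected (G : Graph α β) (k : ℕ) : Prop :=
  ∀ x ∈ G.vertexSet, ∀ y ∈ G.vertexSet, x ≠ y →
    ∃ P : Fin k → List (β × α), (∀ i, IsPath G x (P i) y) ∧
      ∀ i j, i ≠ j → List.Disjoint ((P i).map Prod.fst) ((P j).map Prod.fst)

/-- A set of deterministic routing functions, one for each vertex. The function of the vertex `v`
takes the set of active edges incident at `v` and the edge along which the packet arrived (`none`
if the packet originates at `v`), and returns one of these active edges, along which the packet is
forwarded (or `none`, in which case the packet is not forwarded). -/
structure DetRouting (α β : Type*) where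
  next : α → Set β → Option β → Option β
  next_mem : ∀ v A i e, next v A i = some e → e ∈ A

/-- The active edges incident at `v` when the edges in `F` have failed. -/
def activeEdges (G : Graph α β) (F : Set β) (v : α) : Set β :=
  {e | G.Inc e v ∧ e ∉ F}

/-- One hop. The state of a packet is the vertex at which it is, together with the edge along
which it arrived there. -/
def Hop (G : Graph α β) (R : DetRouting α β) (F : Set β) (s t : α × Option β) : Prop :=
  ∃ e, R.next s.1 (activeEdges G F s.1) s.2 = some e ∧ G.IsLink e s.1 t.1 ∧ t.2 = some e

/-- A packet that originates at `v` and is routed according to `R` reaches `d` when the edges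
in `F` have failed. -/
def Delivers (G : Graph α β) (R : DetRouting α β) (F : Set β) (v d : α) : Prop :=
  ∃ i : Option β, Relation.ReflTransGen (Hop G R F) (v, none) (d, i)

/-- `R` is `c`-resilient for the destination `d`: whenever at most `c` edges fail, each packet
reaches `d` if its origin is still joined to `d` by a path of non-failed edges. -/
def Resilient (G : Graph α β) (d : α) (c : ℕ) (R : DetRouting α β) : Prop :=
  ∀ F ⊆ G.edgeSet, F.encard ≤ c → ∀ v ∈ G.vertexSet,
    (∃ p, IsPath (G.deleteEdges F) v p d) → Delivers G R F v d

end FailoverRouting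

/-! Replace each edge by its two opposite arcs. Edge-disjoint paths to `d` bound every cut below, so
Edmonds' theorem (`exists_disjoint_inTrees`) yields `k` arc-disjoint trees directed towards `d`; an
edge may serve two trees, once in each direction. A packet follows a tree and, at a failed arc,
moves to the next tree with an active arc there. If it gets stuck, every tree has a failed arc
(`reaches_or_stuck`). But `k / 2` failed edges give at most `k` failed arcs, so each tree has
exactly one, and both directions of every failed edge occur in trees (`failed_arcs_of_all_failed`).
At the stuck vertex `w`, the reverse of the last tree's failed arc is therefore the only failed arc
of some tree `m`. That arc ends at `w`, so it is not on the route of `m` from `w` to `d`, and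
switching to `m` delivers the packet. -/

namespace FailoverRouting

/-! ### Edmonds' disjoint branchings, by Lovász's argument -/

section Branching

variable {V A : Type*} [DecidableEq V]

/-- The arcs of `E` that leave the set `X` of vertices. -/
def leaving (tail head : A → V) (E : Finset A) (X : Finset V) : Finset A :=
  E.filter fun a => tail a ∈ X ∧ head a ∉ X

theorem mem_leaving {tail head : A → V} {E : Finset A} {X : Finset V} {a : A} :
    a ∈ leaving tail head E X ↔ a ∈ E ∧ tail a ∈ X ∧ head a ∉ X := by
  simp [leaving]

theorem card_leaving_inter_add_card_leaving_union_le (tail head : A → V) (E : Finset A)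
    (X Y : Finset V) :
    (leaving tail head E (X ∩ Y)).card + (leaving tail head E (X ∪ Y)).card ≤
      (leaving tail head E X).card + (leaving tail head E Y).card := by
  simp only [leaving, Finset.card_filter, ← Finset.sum_add_distrib]
  refine Finset.sum_le_sum fun a _ => ?_
  by_cases h1 : tail a ∈ X <;> by_cases h2 : tail a ∈ Y <;> by_cases h3 : head a ∈ X <;>
    by_cases h4 : head a ∈ Y <;> simp [h1, h2, h3, h4]

/-- `E` has at least `k` arcs leaving each nonempty subset of `S` that avoids `d`. -/
def CutBound (tail head : A → V) (E : Finset A) (S : Finset V) (d : V) (k : ℕ) : Prop :=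
  ∀ X ⊆ S, d ∉ X → X.Nonempty → k ≤ (leaving tail head E X).card

/-- The arcs `p u`, for `u ∈ U` other than `d`, form a tree on `U` directed towards `d`. -/
structure IsInTree (tail head : A → V) (E : Finset A) (U : Finset V) (d : V) (p : V → A)
    (r : V → ℕ) : Prop where
  mem : ∀ u ∈ U, u ≠ d → p u ∈ E
  tail_eq : ∀ u ∈ U, u ≠ d → tail (p u) = u
  head_mem : ∀ u ∈ U, u ≠ d → head (p u) ∈ U
  rank_lt : ∀ u ∈ U, u ≠ d → r (head (p u)) < r u

variable [DecidableEq A]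

/-- The arcs of a tree. -/
def treeArcs (U : Finset V) (d : V) (p : V → A) : Finset A := (U.erase d).image p

/-- The step of Lovász's proof of Edmonds' theorem: an arc that can be removed without
destroying the cut bound. -/
theorem exists_arc_of_cutBound {tail head : A → V} {E T : Finset A} {S U : Finset V} {d : V}
    {k : ℕ} (hE : ∀ a ∈ E, head a ∈ S) (hcut : CutBound tail head E S d (k + 1))
    (hT : ∀ a ∈ T, tail a ∈ U) (hd : d ∈ U) (hUS : U ⊂ S)
    (hcutT : CutBound tail head (E \ T) S d k) :
    ∃ a ∈ E, tail a ∈ S ∧ tail a ∉ U ∧ head a ∈ U ∧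
      CutBound tail head (E \ insert a T) S d k := by
  classical
  -- Arcs of `T` start in `U`, so outside `U` the full bound `k + 1` survives their removal.
  have hsame : ∀ X : Finset V, leaving tail head (E \ T) (X \ U) = leaving tail head E (X \ U) := by
    intro X
    ext a
    simp only [mem_leaving, Finset.mem_sdiff]
    constructor
    · rintro ⟨⟨h1, _⟩, h2⟩
      exact ⟨h1, h2⟩
    · rintro ⟨h1, h2⟩
      exact ⟨⟨h1, fun h => h2.1.2 (hT a h)⟩, h2⟩
  have hbound : ∀ X ⊆ S, (X \ U).Nonempty → k + 1 ≤ (leaving tail head (E \ T) (X \ U)).card := by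
    intro X hX hne
    rw [hsame]
    exact hcut _ (Finset.sdiff_subset.trans hX) (by simp [hd]) hne
  -- Removing one more arc is harmless unless it leaves a tight set, one with exactly `k` leaving
  -- arcs.
  have hkeep : ∀ a : A, (∀ Y ⊆ S, d ∉ Y → (leaving tail head (E \ T) Y).card = k →
      tail a ∈ Y → head a ∈ Y) → CutBound tail head (E \ insert a T) S d k := by
    intro a ha Y hY hdY hne
    have h1 := hcutT Y hY hdY hne
    have h2 : (leaving tail head (E \ T) Y).erase a ⊆ leaving tail head (E \ insert a T) Y := by
      intro b
      simp only [Finset.mem_erase, mem_leaving, Finset.mem_sdiff, Finset.mem_insert]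
      tauto
    have h3 := Finset.card_le_card h2
    by_cases hm : a ∈ leaving tail head (E \ T) Y
    · rw [Finset.card_erase_of_mem hm] at h3
      have h4 : (leaving tail head (E \ T) Y).card ≠ k := by
        intro h
        rw [mem_leaving] at hm
        exact hm.2.2 (ha Y hY hdY h hm.2.1)
      omega
    · rw [Finset.erase_eq_of_notMem hm] at h3
      omega
  let C := S.powerset.filter fun X =>
    d ∉ X ∧ (X \ U).Nonempty ∧ (leaving tail head (E \ T) X).card = k
  by_cases hC : C.Nonempty
  · obtain ⟨X, hXC, hmin⟩ := Finset.exists_min_image C Finset.card hC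
    simp only [C, Finset.mem_filter, Finset.mem_powerset] at hXC hmin
    obtain ⟨hXS, hdX, hXU, hXk⟩ := hXC
    have hlt : (leaving tail head (E \ T) X).card < (leaving tail head (E \ T) (X \ U)).card := by
      have := hbound X hXS hXU
      omega
    obtain ⟨a, ha, ha'⟩ := Finset.exists_mem_notMem_of_card_lt_card hlt
    simp only [mem_leaving, Finset.mem_sdiff] at ha ha'
    obtain ⟨⟨haE, haT⟩, ⟨htX, htU⟩, hh⟩ := ha
    have hhX : head a ∈ X := by
      by_contra h
      exact ha' ⟨⟨haE, haT⟩, htX, h⟩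
    have hhU : head a ∈ U := by
      by_contra h
      exact hh ⟨hhX, h⟩
    refine ⟨a, haE, hXS htX, htU, hhU, hkeep a ?_⟩
    intro Y hYS hdY hYk htY
    by_contra hhY
    -- By submodularity `X ∩ Y` is tight too. It contains `tail a`, outside `U`, but not `head a`,
    -- which contradicts the minimality of `X`.
    have hsub := card_leaving_inter_add_card_leaving_union_le tail head (E \ T) X Y
    have h1 := hcutT (X ∩ Y) (Finset.inter_subset_left.trans hXS) (by simp [hdX])
      ⟨tail a, by simp [htX, htY]⟩
    have h2 := hcutT (X ∪ Y) (Finset.union_subset hXS hYS) (by simp [hdX, hdY])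
      ⟨tail a, by simp [htX]⟩
    have h3 := hmin (X ∩ Y) ⟨Finset.inter_subset_left.trans hXS, by simp [hdX],
      ⟨tail a, by simp [htX, htY, htU]⟩, by omega⟩
    have h4 : X ∩ Y ⊂ X :=
      ⟨Finset.inter_subset_left, fun h => hhY (Finset.mem_inter.1 (h hhX)).2⟩
    exact absurd (Finset.card_lt_card h4) (by omega)
  · have hne : (S \ U).Nonempty := Finset.sdiff_nonempty.2 hUS.2
    have h1 := hbound S subset_rfl hne
    obtain ⟨a, ha⟩ := Finset.card_pos.1 (by omega : 0 < (leaving tail head (E \ T) (S \ U)).card)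
    simp only [mem_leaving, Finset.mem_sdiff] at ha
    obtain ⟨⟨haE, haT⟩, ⟨htS, htU⟩, hh⟩ := ha
    refine ⟨a, haE, htS, htU, ?_, hkeep a ?_⟩
    · by_contra h
      exact hh ⟨hE a haE, h⟩
    · intro Y hYS hdY hYk htY
      refine absurd ⟨Y, ?_⟩ hC
      simp only [C, Finset.mem_filter, Finset.mem_powerset]
      exact ⟨hYS, hdY, ⟨tail a, by simp [htY, htU]⟩, hYk⟩

/-- The tree grows by one vertex at a time. The bound on `r` lets the new leaf take rank `n + 1`,
above its parent. -/
theorem exists_partial_inTree {tail head : A → V} {E : Finset A} {S : Finset V} {d : V}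
    {k : ℕ} (hE : ∀ a ∈ E, head a ∈ S) (hd : d ∈ S) (a₀ : A)
    (hcut : CutBound tail head E S d (k + 1)) (n : ℕ) (hn : n < S.card) :
    ∃ U ⊆ S, U.card = n + 1 ∧ d ∈ U ∧ ∃ p r, IsInTree tail head E U d p r ∧
      (∀ u ∈ U, r u ≤ n) ∧ CutBound tail head (E \ treeArcs U d p) S d k := by
  induction n with
  | zero =>
    refine ⟨{d}, by simpa using hd, by simp, by simp, fun _ => a₀, fun _ => 0, ?_, by simp, ?_⟩
    · constructor <;> simp
    · intro X hX hdX hne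
      have := hcut X hX hdX hne
      simp only [treeArcs, Finset.erase_singleton, Finset.image_empty, Finset.sdiff_empty]
      omega
  | succ n ih =>
    obtain ⟨U, hUS, hcard, hdU, p, r, hp, hr, hc⟩ := ih (by omega)
    have hss : U ⊂ S := by
      refine ⟨hUS, fun h => ?_⟩
      have := Finset.card_le_card h
      omega
    have htail : ∀ a ∈ treeArcs U d p, tail a ∈ U := by
      intro a ha
      simp only [treeArcs, Finset.mem_image, Finset.mem_erase] at ha
      obtain ⟨u, ⟨hud, hu⟩, rfl⟩ := ha
      rw [hp.tail_eq u hu hud]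
      exact hu
    obtain ⟨a, haE, haS, haU, hhU, hac⟩ := exists_arc_of_cutBound hE hcut htail hdU hss hc
    have hne : ∀ u ∈ U, u ≠ tail a := fun u hu h => haU (h ▸ hu)
    refine ⟨insert (tail a) U, Finset.insert_subset haS hUS, ?_, by simp [hdU],
      Function.update p (tail a) a, Function.update r (tail a) (n + 1), ?_, ?_, ?_⟩
    · rw [Finset.card_insert_of_notMem haU, hcard]
    · constructor
      · intro u hu hud
        rcases Finset.mem_insert.1 hu with rfl | hu
        · simpa using haE
        · rw [Function.update_of_ne (hne u hu)]
          exact hp.mem u hu hud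
      · intro u hu hud
        rcases Finset.mem_insert.1 hu with rfl | hu
        · simp
        · rw [Function.update_of_ne (hne u hu)]
          exact hp.tail_eq u hu hud
      · intro u hu hud
        rcases Finset.mem_insert.1 hu with rfl | hu
        · simp [hhU]
        · rw [Function.update_of_ne (hne u hu)]
          exact Finset.mem_insert_of_mem (hp.head_mem u hu hud)
      · intro u hu hud
        rcases Finset.mem_insert.1 hu with rfl | hu
        · rw [Function.update_self, Function.update_self, Function.update_of_ne (hne _ hhU)]
          have := hr _ hhU
          omega
        · rw [Function.update_of_ne (hne u hu), Function.update_of_ne (hne u hu),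
            Function.update_of_ne (hne _ (hp.head_mem u hu hud))]
          exact hp.rank_lt u hu hud
    · intro u hu
      rcases Finset.mem_insert.1 hu with rfl | hu
      · simp
      · rw [Function.update_of_ne (hne u hu)]
        have := hr u hu
        omega
    · have : treeArcs (insert (tail a) U) d (Function.update p (tail a) a) =
          insert a (treeArcs U d p) := by
        simp only [treeArcs]
        rw [Finset.erase_insert_of_ne (hne d hdU).symm, Finset.image_insert,
          Function.update_self]
        congr 1
        refine Finset.image_congr fun u hu => ?_
        exact Function.update_of_ne (hne u (Finset.mem_of_mem_erase hu)) _ _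
      rw [this]
      exact hac

/-- Edmonds' theorem on disjoint branchings. -/
theorem exists_disjoint_inTrees {tail head : A → V} {S : Finset V} {d : V} (hd : d ∈ S) (a₀ : A)
    (k : ℕ) : ∀ E : Finset A, (∀ a ∈ E, head a ∈ S) → CutBound tail head E S d k →
    ∃ (p : Fin k → V → A) (r : Fin k → V → ℕ), (∀ i, IsInTree tail head E S d (p i) (r i)) ∧
      ∀ i j, ∀ v ∈ S, v ≠ d → p i v = p j v → i = j := by
  induction k with
  | zero => exact fun E _ _ => ⟨fun i => i.elim0, fun i => i.elim0, fun i => i.elim0,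
      fun i => i.elim0⟩
  | succ k ih =>
    intro E hE hcut
    have hpos := Finset.card_pos.2 ⟨d, hd⟩
    obtain ⟨U, hUS, hcard, -, p, r, hp, -, hc⟩ :=
      exists_partial_inTree hE hd a₀ hcut (S.card - 1) (by omega)
    obtain rfl : U = S := Finset.eq_of_subset_of_card_le hUS (by omega)
    obtain ⟨q, s, hq, hqd⟩ :=
      ih (E \ treeArcs U d p) (fun a ha => hE a (Finset.mem_sdiff.1 ha).1) hc
    have hne : ∀ i, ∀ v ∈ U, v ≠ d → p v ≠ q i v := by
      intro i v hv hvd h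
      refine (Finset.mem_sdiff.1 ((hq i).mem v hv hvd)).2 ?_
      rw [← h]
      exact Finset.mem_image_of_mem _ (Finset.mem_erase.2 ⟨hvd, hv⟩)
    refine ⟨Fin.cons p q, Fin.cons r s, ?_, ?_⟩
    · intro i
      refine Fin.cases ?_ (fun i => ?_) i
      · simpa using hp
      · simp only [Fin.cons_succ]
        exact ⟨fun u hu hud => (Finset.mem_sdiff.1 ((hq i).mem u hu hud)).1, (hq i).tail_eq,
          (hq i).head_mem, (hq i).rank_lt⟩
    · intro i j v hv hvd
      refine Fin.cases ?_ (fun i => ?_) i <;> refine Fin.cases ?_ (fun j => ?_) j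
      · simp
      · intro h
        exact absurd h (by simpa using hne j v hv hvd)
      · intro h
        exact absurd h.symm (by simpa using hne i v hv hvd)
      · intro h
        rw [hqd i j v hv hvd (by simpa using h)]

end Branching

/-! ### Arc-disjoint trees in the multigraph -/

variable {α β : Type*}

/-- Pairwise disjoint trees of arcs `(tail, edge, head)` of `G` on the set `S`, directed towards
`d`; the arc by which the tree `i` leaves `v` is `(v, edge i v, parent i v)`. -/
structure TreeSystem (G : Graph α β) (S : Set α) (d : α) (k : ℕ) where
  edge : Fin k → α → β
  parent : Fin k → α → α
  rank : Fin k → α → ℕ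
  isLink : ∀ i, ∀ v ∈ S, v ≠ d → G.IsLink (edge i v) v (parent i v)
  parent_mem : ∀ i, ∀ v ∈ S, v ≠ d → parent i v ∈ S
  rank_lt : ∀ i, ∀ v ∈ S, v ≠ d → rank i (parent i v) < rank i v
  edge_inj : ∀ i j, ∀ v ∈ S, v ≠ d → edge i v = edge j v → i = j

theorem exists_link_leaving {G : Graph α β} {X : Set α} {d : α} (hd : d ∉ X) :
    ∀ (p : List (β × α)) (x : α), x ∈ X → IsWalk G x p d →
      ∃ e u w, e ∈ p.map Prod.fst ∧ G.IsLink e u w ∧ u ∈ X ∧ w ∉ X := by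
  intro p
  induction p with
  | nil =>
    rintro x hx ⟨-, rfl⟩
    exact absurd hx hd
  | cons a p ih =>
    obtain ⟨e, z⟩ := a
    rintro x hx ⟨h1, h2⟩
    by_cases hz : z ∈ X
    · obtain ⟨e', u, w, he, h⟩ := ih z hz h2
      exact ⟨e', u, w, by simpa using Or.inr (by simpa using he), h⟩
    · exact ⟨e, x, z, by simp, h1, hx, hz⟩

theorem nonempty_treeSystem [Nonempty β] {G : Graph α β} (hV : G.vertexSet.Finite) (hE : G.edgeSet.Finite)
    {S : Set α} {d : α} {k : ℕ} (hd : d ∈ S) (hSV : S ⊆ G.vertexSet)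
    (hS : ∀ e x y, G.IsLink e x y → x ∈ S → y ∈ S)
    (hP : ∀ x ∈ S, x ≠ d → ∃ P : Fin k → List (β × α), (∀ i, IsWalk G x (P i) d) ∧
      ∀ i j, i ≠ j → List.Disjoint ((P i).map Prod.fst) ((P j).map Prod.fst)) :
    Nonempty (TreeSystem G S d k) := by
  classical
  have hSf : S.Finite := hV.subset hSV
  have hAf : {a : α × β × α | a.1 ∈ S ∧ G.IsLink a.2.1 a.1 a.2.2}.Finite := by
    refine (hSf.prod (hE.prod hSf)).subset ?_
    rintro ⟨x, e, y⟩ ⟨h1, h2⟩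
    exact ⟨h1, h2.edge_mem, hS e x y h2 h1⟩
  have hA : ∀ a : α × β × α, a ∈ hAf.toFinset ↔ a.1 ∈ S ∧ G.IsLink a.2.1 a.1 a.2.2 := by
    intro a
    simp
  obtain ⟨p, r, hp, hdis⟩ := exists_disjoint_inTrees (tail := fun a : α × β × α => a.1)
    (head := fun a => a.2.2) (S := hSf.toFinset) (d := d) (by simpa using hd)
    (d, Classical.arbitrary β, d) k hAf.toFinset
    (by
      intro a ha
      rw [hA] at ha
      simpa using hS _ _ _ ha.2 ha.1)
    (by
      intro X hX hdX ⟨x, hx⟩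
      obtain ⟨P, hPw, hPd⟩ := hP x (by simpa using hX hx) (fun h => hdX (h ▸ hx))
      have hl := fun i => exists_link_leaving (X := X) (by simpa using hdX) (P i) x
        (by simpa using hx) (hPw i)
      choose e u w he hl hu hw using hl
      -- Each of the `k` walks contributes an arc leaving `X`; edge-disjointness makes these arcs
      -- distinct.
      have hinj : Function.Injective fun i => (u i, e i, w i) := by
        intro i j hij
        by_contra hne
        simp only [Prod.mk.injEq] at hij
        exact hPd i j hne (he i) (hij.2.1 ▸ he j)
      have := Finset.card_le_card_of_injOn (s := Finset.univ)
        (t := leaving (fun a : α × β × α => a.1) (fun a => a.2.2) hAf.toFinset X)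
        (fun i => (u i, e i, w i))
        (by
          intro i _
          simp only [Finset.mem_coe, mem_leaving, hA]
          exact ⟨⟨by simpa using hX (hu i), hl i⟩, hu i, hw i⟩)
        hinj.injOn
      simpa using this)
  have hlink : ∀ i, ∀ v ∈ S, v ≠ d → G.IsLink (p i v).2.1 v (p i v).2.2 := by
    intro i v hv hvd
    have h1 := (hp i).mem v (by simpa using hv) hvd
    have h2 := (hp i).tail_eq v (by simpa using hv) hvd
    rw [hA] at h1
    simpa only [h2] using h1.2
  refine ⟨⟨fun i v => (p i v).2.1, fun i v => (p i v).2.2, r, hlink, ?_, ?_, ?_⟩⟩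
  · intro i v hv hvd
    simpa using (hp i).head_mem v (by simpa using hv) hvd
  · intro i v hv hvd
    exact (hp i).rank_lt v (by simpa using hv) hvd
  · intro i j v hv hvd h
    refine hdis i j v (by simpa using hv) hvd ?_
    have h1 := (hp i).tail_eq v (by simpa using hv) hvd
    have h2 := (hp j).tail_eq v (by simpa using hv) hvd
    have h3 := hlink i v hv hvd
    rw [h] at h3
    exact Prod.ext (h1.trans h2.symm) (Prod.ext h (h3.right_unique (hlink j v hv hvd)))

/-! ### The routing functions and their resilience -/

namespace TreeSystem

variable {G : Graph α β} {S : Set α} {d : α} {k : ℕ}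

/-- A packet in the given state follows the tree `l`; packets start on the tree `0`. -/
def IsOn (T : TreeSystem G S d (k + 1)) (v : α) : Option β → Fin (k + 1) → Prop
  | none, l => l = 0
  | some e, l => ∃ u ∈ S, u ≠ d ∧ T.edge l u = e ∧ T.parent l u = v

/-- The arrival edge and the current vertex determine the arc just used, and an arc lies in only one
tree; so the packet needs no header to record its tree. -/
theorem IsOn.unique {T : TreeSystem G S d (k + 1)} {v : α} {i : Option β} {l m : Fin (k + 1)}
    (hl : T.IsOn v i l) (hm : T.IsOn v i m) : l = m := by
  cases i with
  | none => exact hl.trans hm.symm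
  | some e =>
    obtain ⟨u, hu, hud, he, hp⟩ := hl
    obtain ⟨u', hu', hud', he', hp'⟩ := hm
    have h1 := T.isLink l u hu hud
    have h2 := T.isLink m u' hu' hud'
    rw [he, hp] at h1
    rw [he', hp'] at h2
    obtain rfl := h1.left_unique h2
    exact T.edge_inj l m u hu hud (he.trans he'.symm)

/-- The tree `m` is the first one from the tree `l` on whose edge at `v` is in `A`. -/
def IsFirst (T : TreeSystem G S d (k + 1)) (v : α) (A : Set β) (l m : Fin (k + 1)) : Prop :=
  l ≤ m ∧ T.edge m v ∈ A ∧ ∀ m', l ≤ m' → m' < m → T.edge m' v ∉ A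

theorem IsFirst.unique {T : TreeSystem G S d (k + 1)} {v : α} {A : Set β} {l m n : Fin (k + 1)}
    (hm : T.IsFirst v A l m) (hn : T.IsFirst v A l n) : m = n := by
  rcases lt_trichotomy m n with h | h | h
  · exact absurd hm.2.1 (hn.2.2 m hm.1 h)
  · exact h
  · exact absurd hn.2.1 (hm.2.2 n hn.1 h)

theorem exists_isFirst {T : TreeSystem G S d (k + 1)} {v : α} {A : Set β} {l m : Fin (k + 1)}
    (hlm : l ≤ m) (hm : T.edge m v ∈ A) : ∃ n, T.IsFirst v A l n := by
  obtain ⟨n, hn, hmin⟩ := WellFounded.has_min (wellFounded_lt (α := Fin (k + 1)))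
    {n | l ≤ n ∧ T.edge n v ∈ A} ⟨m, hlm, hm⟩
  exact ⟨n, hn.1, hn.2, fun m' h1 h2 h3 => hmin m' ⟨h1, h3⟩ h2⟩

/-- The tree `m` contains the reverse of the arc by which the last tree leaves `v`. -/
def IsBounce (T : TreeSystem G S d (k + 1)) (v : α) (m : Fin (k + 1)) : Prop :=
  T.parent (Fin.last k) v ∈ S ∧ T.parent (Fin.last k) v ≠ d ∧
    T.edge m (T.parent (Fin.last k) v) = T.edge (Fin.last k) v

theorem IsBounce.unique {T : TreeSystem G S d (k + 1)} {v : α} {m n : Fin (k + 1)}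
    (hm : T.IsBounce v m) (hn : T.IsBounce v n) : m = n :=
  T.edge_inj m n _ hm.1 hm.2.1 (hm.2.2.trans hn.2.2.symm)

open Classical in
/-- The tree along which a packet is forwarded: the first usable one from the current tree on;
if there is none, the tree that contains the reverse of the failed arc of the last tree. -/
noncomputable def select (T : TreeSystem G S d (k + 1)) (v : α) (A : Set β) (i : Option β) :
    Fin (k + 1) :=
  if ∃ l m, T.IsOn v i l ∧ T.IsFirst v A l m then
    Classical.epsilon fun m => ∃ l, T.IsOn v i l ∧ T.IsFirst v A l m
  else Classical.epsilon fun m => T.IsBounce v m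

theorem select_eq_of_isFirst {T : TreeSystem G S d (k + 1)} {v : α} {A : Set β} {i : Option β}
    {l m : Fin (k + 1)} (hl : T.IsOn v i l) (hm : T.IsFirst v A l m) : T.select v A i = m := by
  have h : ∃ m, ∃ l, T.IsOn v i l ∧ T.IsFirst v A l m := ⟨m, l, hl, hm⟩
  rw [select, if_pos ⟨l, m, hl, hm⟩]
  obtain ⟨l', hl', hm'⟩ := Classical.epsilon_spec h
  obtain rfl := hl.unique hl'
  exact hm'.unique hm

theorem select_eq_of_isBounce {T : TreeSystem G S d (k + 1)} {v : α} {A : Set β} {i : Option β}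
    {l m : Fin (k + 1)} (hl : T.IsOn v i l) (hA : ∀ n, l ≤ n → T.edge n v ∉ A)
    (hm : T.IsBounce v m) : T.select v A i = m := by
  rw [select, if_neg]
  · exact (Classical.epsilon_spec ⟨m, hm⟩).unique hm
  · rintro ⟨l', n, hl', hn⟩
    obtain rfl := hl.unique hl'
    exact hA n hn.1 hn.2.1

open Classical in
/-- The routing functions given by a system of disjoint trees. -/
noncomputable def routing (T : TreeSystem G S d (k + 1)) : DetRouting α β where
  next v A i := if T.edge (T.select v A i) v ∈ A then some (T.edge (T.select v A i) v) else none
  next_mem v A i e h := by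
    split_ifs at h with h'
    obtain rfl := Option.some.inj h
    exact h'

variable {T : TreeSystem G S d (k + 1)} {F : Set β}

theorem edge_mem_activeEdges {v : α} (hv : v ∈ S) (hvd : v ≠ d) (m : Fin (k + 1)) :
    T.edge m v ∈ activeEdges G F v ↔ T.edge m v ∉ F :=
  ⟨fun h => h.2, fun h => ⟨(T.isLink m v hv hvd).inc_left, h⟩⟩

theorem hop_of_select_eq {v : α} {i : Option β} {m : Fin (k + 1)} (hv : v ∈ S) (hvd : v ≠ d)
    (hm : T.select v (activeEdges G F v) i = m) (hF : T.edge m v ∉ F) :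
    Hop G T.routing F (v, i) (T.parent m v, some (T.edge m v)) := by
  refine ⟨T.edge m v, ?_, T.isLink m v hv hvd, rfl⟩
  have hA := (edge_mem_activeEdges (F := F) hv hvd m).2 hF
  simp only [routing]
  rw [hm, if_pos hA]

theorem isOn_parent {v : α} (hv : v ∈ S) (hvd : v ≠ d) (m : Fin (k + 1)) :
    T.IsOn (T.parent m v) (some (T.edge m v)) m :=
  ⟨v, hv, hvd, rfl, rfl⟩

theorem reaches_of_no_failure_below {m : Fin (k + 1)} (n : ℕ) :
    ∀ (v : α) (i : Option β), v ∈ S → T.rank m v = n → T.IsOn v i m →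
      (∀ u ∈ S, u ≠ d → T.rank m u ≤ n → T.edge m u ∉ F) →
      ∃ j, Relation.ReflTransGen (Hop G T.routing F) (v, i) (d, j) := by
  induction n using Nat.strong_induction_on with
  | _ n ih =>
    intro v i hv hr hi hF
    by_cases hvd : v = d
    · subst hvd
      exact ⟨i, .refl⟩
    have hFv := hF v hv hvd hr.le
    have hsel := select_eq_of_isFirst hi (A := activeEdges G F v)
      ⟨le_rfl, (edge_mem_activeEdges hv hvd m).2 hFv, fun m' h1 h2 => absurd h1 (not_le.2 h2)⟩
    have hlt := T.rank_lt m v hv hvd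
    obtain ⟨j, hj⟩ := ih (T.rank m (T.parent m v)) (hr ▸ hlt) _ _ (T.parent_mem m v hv hvd) rfl
      (isOn_parent hv hvd m) (fun u hu hud h => hF u hu hud (by omega))
    exact ⟨j, .head (hop_of_select_eq hv hvd hsel hFv) hj⟩

/-- Each hop either keeps the tree and lowers the rank or raises the tree index, whence the
lexicographic induction on `k - l` and the rank. Every tree skipped or abandoned on the way exhibits
a failed arc. -/
theorem reaches_or_stuck (c n : ℕ) :
    ∀ (l : Fin (k + 1)) (v : α) (i : Option β), k - l = c → v ∈ S → T.rank l v = n →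
      T.IsOn v i l →
      (∃ j, Relation.ReflTransGen (Hop G T.routing F) (v, i) (d, j)) ∨
      ((∀ m, l ≤ m → ∃ u ∈ S, u ≠ d ∧ T.edge m u ∈ F) ∧
        ∃ l' w j, Relation.ReflTransGen (Hop G T.routing F) (v, i) (w, j) ∧ w ∈ S ∧ w ≠ d ∧
          T.IsOn w j l' ∧ ∀ m, l' ≤ m → T.edge m w ∈ F) := by
  induction c using Nat.strong_induction_on generalizing n with
  | _ c ihc =>
    induction n using Nat.strong_induction_on with
    | _ n ihn =>
      intro l v i hc hv hr hi
      by_cases hvd : v = d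
      · subst hvd
        exact .inl ⟨i, .refl⟩
      by_cases hall : ∀ m, l ≤ m → T.edge m v ∈ F
      · exact .inr ⟨fun m hm => ⟨v, hv, hvd, hall m hm⟩, l, v, i, .refl, hv, hvd, hi, hall⟩
      push Not at hall
      obtain ⟨m₀, hlm₀, hm₀⟩ := hall
      obtain ⟨m, hm⟩ := exists_isFirst hlm₀ ((edge_mem_activeEdges hv hvd m₀).2 hm₀)
      have hmF := (edge_mem_activeEdges hv hvd m).1 hm.2.1
      have hhop := hop_of_select_eq hv hvd (select_eq_of_isFirst hi hm) hmF
      have hnext : (∃ j, Relation.ReflTransGen (Hop G T.routing F)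
            (T.parent m v, some (T.edge m v)) (d, j)) ∨
          ((∀ m', m ≤ m' → ∃ u ∈ S, u ≠ d ∧ T.edge m' u ∈ F) ∧
            ∃ l' w j, Relation.ReflTransGen (Hop G T.routing F)
              (T.parent m v, some (T.edge m v)) (w, j) ∧ w ∈ S ∧ w ≠ d ∧
              T.IsOn w j l' ∧ ∀ m', l' ≤ m' → T.edge m' w ∈ F) := by
        rcases hm.1.eq_or_lt with h | h
        · subst h
          exact ihn _ (hr ▸ T.rank_lt l v hv hvd) l _ _ hc (T.parent_mem l v hv hvd) rfl
            (isOn_parent hv hvd l)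
        · have h' : (l : ℕ) < m := h
          exact ihc (k - m) (by omega) _ m _ _ rfl (T.parent_mem m v hv hvd) rfl
            (isOn_parent hv hvd m)
      rcases hnext with ⟨j, hj⟩ | ⟨h1, l', w, j, hj, h2⟩
      · exact .inl ⟨j, .head hhop hj⟩
      · refine .inr ⟨fun m' hm' => ?_, l', w, j, .head hhop hj, h2⟩
        rcases le_or_gt m m' with h | h
        · exact h1 m' h
        · refine ⟨v, hv, hvd, ?_⟩
          by_contra hF
          exact hm.2.2 m' hm' h ((edge_mem_activeEdges hv hvd m').2 hF)

/-- If each tree has a failed arc, but at most `(k + 1) / 2` edges failed, then each tree has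
just one failed arc, and the reverse of each failed arc is in one of the trees. -/
theorem failed_arcs_of_all_failed (hFf : F.Finite) (hF : 2 * hFf.toFinset.card ≤ k + 1)
    (hbad : ∀ m, ∃ u ∈ S, u ≠ d ∧ T.edge m u ∈ F) :
    (∀ m u w, u ∈ S → u ≠ d → T.edge m u ∈ F → w ∈ S → w ≠ d → T.edge m w ∈ F → u = w) ∧
    ∀ e x y, e ∈ F → G.IsLink e x y → ∃ m, x ∈ S ∧ x ≠ d ∧ T.edge m x = e := by
  classical
  choose b hbS hbd hbF using hbad
  -- Failed arcs are counted as pairs (edge, tail); an edge has at most two ends.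
  have hcard : ∀ Q : Finset (β × α), (∀ q ∈ Q, q.1 ∈ F ∧ G.Inc q.1 q.2) → Q.card ≤ k + 1 := by
    intro Q hQ
    refine le_trans ?_ hF
    refine Finset.card_le_mul_card_image_of_maps_to (f := Prod.fst)
      (fun q hq => by simpa using (hQ q hq).1) 2 fun e _ => ?_
    by_cases hne : (Q.filter fun q => q.1 = e).Nonempty
    · obtain ⟨⟨e', x⟩, hq⟩ := hne
      simp only [Finset.mem_filter] at hq
      obtain ⟨hq, rfl⟩ := hq
      obtain ⟨y, hxy⟩ := (hQ _ hq).2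
      refine (Finset.card_le_card (t := {(e', x), (e', y)}) ?_).trans Finset.card_le_two
      rintro ⟨e, z⟩ hz
      simp only [Finset.mem_filter] at hz
      obtain ⟨hz, rfl⟩ := hz
      obtain ⟨z', hzz⟩ := (hQ _ hz).2
      rcases hxy.eq_and_eq_or_eq_and_eq hzz with h | h
      · simp [show z = x from h.1.symm]
      · simp [show z = y from h.2.symm]
    · rw [Finset.not_nonempty_iff_eq_empty.1 hne]
      simp
  have hbinc : ∀ m, G.Inc (T.edge m (b m)) (b m) := fun m =>
    (T.isLink m _ (hbS m) (hbd m)).inc_left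
  have hinj : Function.Injective fun m => (T.edge m (b m), b m) := by
    intro m n h
    simp only [Prod.mk.injEq] at h
    refine T.edge_inj m n (b m) (hbS m) (hbd m) ?_
    rw [h.1, h.2]
  -- The chosen failed arcs, one per tree, already exhaust the bound `k + 1`, so no other pair
  -- exists.
  have key : ∀ e x, e ∈ F → G.Inc e x → ∃ m, e = T.edge m (b m) ∧ x = b m := by
    intro e x he hx
    by_contra! hno
    have h1 : (e, x) ∉ Finset.univ.image fun m => (T.edge m (b m), b m) := by
      simp only [Finset.mem_image, Finset.mem_univ, true_and, Prod.mk.injEq, not_exists, not_and]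
      exact fun m h h' => hno m h.symm h'.symm
    have h2 := hcard (insert (e, x) (Finset.univ.image fun m => (T.edge m (b m), b m))) (by
      intro q hq
      simp only [Finset.mem_insert, Finset.mem_image, Finset.mem_univ, true_and] at hq
      rcases hq with rfl | ⟨m, rfl⟩
      · exact ⟨he, hx⟩
      · exact ⟨hbF m, hbinc m⟩)
    rw [Finset.card_insert_of_notMem h1, Finset.card_image_of_injective _ hinj,
      Finset.card_univ, Fintype.card_fin] at h2
    omega
  have huniq : ∀ m u, u ∈ S → u ≠ d → T.edge m u ∈ F → u = b m := by
    intro m u hu hud hF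
    obtain ⟨n, h1, h2⟩ := key _ u hF (T.isLink m u hu hud).inc_left
    rw [← h2] at h1
    rw [T.edge_inj m n u hu hud h1, ← h2]
  constructor
  · intro m u w hu hud hFu hw hwd hFw
    rw [huniq m u hu hud hFu, huniq m w hw hwd hFw]
  · intro e x y he hxy
    obtain ⟨m, rfl, rfl⟩ := key e x he hxy.inc_left
    exact ⟨m, hbS m, hbd m, rfl⟩

theorem delivers (hFf : F.Finite) (hF : 2 * hFf.toFinset.card ≤ k + 1) {v : α} (hv : v ∈ S) :
    Delivers G T.routing F v d := by
  rcases reaches_or_stuck (T := T) (F := F) _ _ 0 v none rfl hv rfl rfl with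
    h | ⟨hbad, l, w, i, hreach, hw, hwd, hi, hfail⟩
  · exact h
  obtain ⟨huniq, hrev⟩ := failed_arcs_of_all_failed hFf hF fun m => hbad m (Fin.zero_le m)
  have hlink := T.isLink (Fin.last k) w hw hwd
  have hlast := hfail _ (Fin.le_last l)
  obtain ⟨m, hpS, hpd, hm⟩ := hrev _ _ _ hlast hlink.symm
  have hparent : T.parent m (T.parent (Fin.last k) w) = w := by
    have := T.isLink m _ hpS hpd
    rw [hm] at this
    exact this.right_unique hlink.symm
  have hrank := T.rank_lt m _ hpS hpd
  rw [hparent] at hrank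
  -- The only failed arc of `m` starts at the parent of `w` in the last tree, whose rank in `m`
  -- exceeds that of `w`.
  have hgood : ∀ u ∈ S, u ≠ d → T.rank m u ≤ T.rank m w → T.edge m u ∉ F := by
    intro u hu hud hle hFu
    have := huniq m u _ hu hud hFu hpS hpd (hm ▸ hlast)
    subst this
    omega
  have hsel := select_eq_of_isBounce (A := activeEdges G F w) hi
    (fun n hn h => h.2 (hfail n hn)) ⟨hpS, hpd, hm⟩
  have hhop := hop_of_select_eq hw hwd hsel (hgood w hw hwd le_rfl)
  have hlt := T.rank_lt m w hw hwd
  obtain ⟨j, hj⟩ := reaches_of_no_failure_below _ _ _ (T.parent_mem m w hw hwd) rfl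
    (isOn_parent hw hwd m) (fun u hu hud h => hgood u hu hud (by omega))
  exact ⟨j, hreach.trans (.head hhop hj)⟩

end TreeSystem

/-! ### From connectivity to resilient routing -/

theorem IsWalk.mono {G H : Graph α β} (hGH : H ≤ G) :
    ∀ {p : List (β × α)} {x y : α}, IsWalk H x p y → IsWalk G x p y
  | [], _, _, h => ⟨hGH.vertexSet_mono h.1, h.2⟩
  | (_, _) :: _, _, _, h => ⟨hGH.isLink_mono h.1, h.2.mono hGH⟩

theorem IsWalk.left_mem {G : Graph α β} :
    ∀ {p : List (β × α)} {x y : α}, IsWalk G x p y → x ∈ G.vertexSet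
  | [], _, _, h => h.1
  | (_, _) :: _, _, _, h => h.1.left_mem

theorem exists_resilient_of_walks {G : Graph α β} (hV : G.vertexSet.Finite)
    (hE : G.edgeSet.Finite) {d : α} (hd : d ∈ G.vertexSet) {k c : ℕ} (hc : 2 * c ≤ k + 1)
    (hP : ∀ x p, IsWalk G x p d → x ≠ d → ∃ P : Fin (k + 1) → List (β × α),
      (∀ i, IsWalk G x (P i) d) ∧
      ∀ i j, i ≠ j → List.Disjoint ((P i).map Prod.fst) ((P j).map Prod.fst)) :
    ∃ R : DetRouting α β, Resilient G d c R := by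
  have hmem : ∀ {F : Set β} {v : α}, (∃ p, IsPath (G.deleteEdges F) v p d) →
      ∃ p, IsWalk G v p d := fun ⟨p, hp⟩ => ⟨p, hp.1.mono Graph.deleteEdges_le⟩
  rcases isEmpty_or_nonempty β with hβ | hβ
  · refine ⟨⟨fun _ _ _ => none, fun _ _ _ _ h => by simp at h⟩, ?_⟩
    intro F _ _ v _ hp
    obtain ⟨p, hp⟩ := hmem hp
    cases p with
    | nil =>
      obtain ⟨-, rfl⟩ := hp
      exact ⟨none, .refl⟩
    | cons a p => exact hβ.elim a.1
  -- The trees span only the component of `d`, which also covers disconnected graphs.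
  obtain ⟨T⟩ : Nonempty (TreeSystem G {v | ∃ p, IsWalk G v p d} d (k + 1)) := by
    refine nonempty_treeSystem hV hE ⟨[], hd, rfl⟩ ?_ ?_ ?_
    · rintro v ⟨p, hp⟩
      exact hp.left_mem
    · rintro e x y hxy ⟨p, hp⟩
      exact ⟨(e, x) :: p, hxy.symm, hp⟩
    · rintro x ⟨p, hp⟩ hx
      exact hP x p hp hx
  refine ⟨T.routing, fun F hFE hFc v _ hp => ?_⟩
  have hFf := hE.subset hFE
  refine T.delivers hFf ?_ (hmem hp)
  rw [hFf.encard_eq_coe_toFinset_card] at hFc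
  have : hFf.toFinset.card ≤ c := by exact_mod_cast hFc
  omega

end FailoverRouting

theorem mainTheorem10 {α β : Type*} (G : Graph α β) (hV : G.vertexSet.Finite)
    (hE : G.edgeSet.Finite) (k : ℕ) (hG : FailoverRouting.EdgeConnected G k)
    (d : α) (hd : d ∈ G.vertexSet) :
    ∃ R : FailoverRouting.DetRouting α β, FailoverRouting.Resilient G d (k / 2) R := by
  rcases Nat.eq_zero_or_pos k with rfl | hk
  -- Without any connectivity, a single tree on the component of `d` suffices, as no edge fails.
  · refine FailoverRouting.exists_resilient_of_walks (k := 0) hV hE hd (by omega) ?_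
    intro x p hp _
    exact ⟨fun _ => p, fun _ => hp, fun i j h => absurd (Fin.ext (by omega)) h⟩
  · obtain ⟨n, rfl⟩ : ∃ n, k = n + 1 := ⟨k - 1, by omega⟩
    refine FailoverRouting.exists_resilient_of_walks (k := n) hV hE hd (by omega) ?_
    intro x p hp hx
    obtain ⟨P, h1, h2⟩ := hG x hp.left_mem d hd hx
    exact ⟨P, fun i => (h1 i).1, h2⟩
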